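/- Let $d\in\{2,3\}$, let $\Omega\subset\mathbb R^d$ be a bounded open set with Lipschitz boundary $\Gamma$, let $0<\alpha<\beta<\infty$, $\gamma>0$, and let $L$ be a number of measurements. Let $f^\ell\in (H^1(\Omega))'$, $g^\ell\in H^{1/2}(\Gamma)$ and $\vec h^\ell\in L^2(\Omega)^d$ for $\ell=1,\dots,L$. Let $\mathcal S_d$ be the space of real symmetric $d\times d$ matrices with the Frobenius inner product $A\cdot B=\sum_{i,j}A_{ij}B_{ij}$, and let $$\mathcal A=\Big\{A\in L^\infty(\Omega)^{d,d}:\ A(x)\in\mathcal S_d,\ \alpha|\xi|^2\le \sum_{i,j=1}^d A_{ij}(x)\xi_i\xi_j\le\beta|\xi|^2\ \ \forall \xi\in\mathbb R^d,\ \text{a.e. } x\in\Omega\Big\}.$$ For $A\in\mathcal A$ let $u^\ell(A)\in H^1(\Omega)$ be the weak solution of $-\mathrm{div}(A\nabla u)=f^\ell$ in $\Omega$, $u=g^\ell$ on $\Gamma$, i.e. $u$ has trace $g^\ell$ and $\int_\Omega A\nabla u\cdot\nabla v\,dx=\langle f^\ell,v\rangle$ for all $v\in H^1_0(\Omega)$.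 Let $$J_\gamma(A)=\frac12\sum_{\ell=1}^L\|A\nabla u^\ell(A)-\vec h^\ell\|_{L^2(\Omega)^d}^2+\frac\gamma2\int_\Omega A\cdot A\,dx .$$ Let $K=\{A\in\mathcal S_d:\alpha I\le A\le\beta I\}$, where $A\le B$ means that $B-A$ is symmetric positive semidefinite, and let $P_K$ be the orthogonal projection onto $K$: $P_K(M)\in K$ and $(M-P_K(M))\cdot(B-P_K(M))\le 0$ for all $B\in K$. For $a,b\in\mathbb R^d$ let $(a\otimes b)_{ij}=\frac12(a_ib_j+a_jb_i)$. **Theorem.** Let $A^*\in\mathcal A$ minimize $J_\gamma$ over $\mathcal A$. Then for each $\ell$ there are the state $u^\ell=u^\ell(A^*)\in H^1(\Omega)$, a weak solution of $$-\mathrm{div}(A^*\nabla u^\ell)=f^\ell\ \text{ in }\Omega,\qquad u^\ell=g^\ell\ \text{ on }\Gamma,$$ and the adjoint $p^\ell\in H^1_0(\Omega)$, the unique weak solution of $$-\mathrm{div}(A^*\nabla p^\ell)=\mathrm{div}\big(A^*(A^*\nabla u^\ell-\vec h^\ell)\big)\ \text{ in }\Omega,\qquad p^\ell=0\ \text{ on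 }\Gamma,$$ i.e. $\int_\Omega A^*\nabla p^\ell\cdot\nabla v\,dx=-\int_\Omega A^*(A^*\nabla u^\ell-\vec h^\ell)\cdot\nabla v\,dx$ for all $v\in H^1_0(\Omega)$. Moreover, for every $\lambda>0$, $$A^*(x)=P_K\Big(A^*-\lambda\Big(\sum_{\ell=1}^L\big(\nabla u^\ell\otimes(A^*\nabla u^\ell-\vec h^\ell)+\nabla u^\ell\otimes\nabla p^\ell\big)+\gamma A^*\Big)\Big)(x)\qquad\text{for a.e. }x\in\Omega.$$ -/

import Mathlib

open MeasureTheory Filter Topology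
open scoped ENNReal NNReal ContDiff

namespace AnisotropicConductivity

noncomputable section

/-! ### Domains -/

/-- The Euclidean space of dimension `d`. -/
abbrev E (d : ℕ) : Type := EuclideanSpace ℝ (Fin d)

/-- `Ω` is a bounded open set with Lipschitz boundary: near each boundary point, in suitable
orthonormal coordinates (with vertical direction `e`), `Ω` is the region strictly above the graph
of a Lipschitz function of the variables orthogonal to `e`. -/
structure IsBoundedLipschitzDomain {d : ℕ} (Ω : Set (E d)) : Prop where
  isOpen : IsOpen Ω
  isBounded : Bornology.IsBounded Ω
  lipschitz_boundary : ∀ x ∈ frontier Ω, ∃ e : E d, ‖e‖ = 1 ∧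
    ∃ (C : ℝ≥0) (ψ : (ℝ ∙ e)ᗮ → ℝ), LipschitzWith C ψ ∧
      ∀ᶠ y in 𝓝 x, y ∈ Ω ↔ ψ ((ℝ ∙ e)ᗮ.orthogonalProjectionOnto y) < inner ℝ e y

/-! ### Sobolev spaces -/

/-- `L²(Ω)`. -/
abbrev L2 {d : ℕ} (Ω : Set (E d)) : Type := Lp ℝ 2 (volume.restrict Ω)

/-- `L²(Ω)^d`. -/
abbrev L2Vec {d : ℕ} (Ω : Set (E d)) : Type := Lp (E d) 2 (volume.restrict Ω)

/-- `φ ∈ C_c^∞(Ω)`. -/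
structure IsTestFunction {d : ℕ} (Ω : Set (E d)) (φ : E d → ℝ) : Prop where
  smooth : ContDiff ℝ ∞ φ
  compact : HasCompactSupport φ
  support_subset : tsupport φ ⊆ Ω

/-- The `i`-th partial derivative of `φ` at `x`. -/
def partialDeriv {d : ℕ} (φ : E d → ℝ) (i : Fin d) (x : E d) : ℝ :=
  fderiv ℝ φ x (EuclideanSpace.single i 1)

/-- The vector field `G` is the weak gradient of `u` on `Ω`. -/
def IsWeakGradient {d : ℕ} (Ω : Set (E d)) (u : E d → ℝ) (G : E d → E d) : Prop :=
  ∀ φ : E d → ℝ, IsTestFunction Ω φ → ∀ i : Fin d,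
    ∫ x in Ω, u x * partialDeriv φ i x = - ∫ x in Ω, G x i * φ x

theorem IsTestFunction.memLp {d : ℕ} {Ω : Set (E d)} {φ : E d → ℝ} (hφ : IsTestFunction Ω φ) :
    MemLp φ 2 (volume.restrict Ω) :=
  (hφ.smooth.continuous.memLp_of_hasCompactSupport hφ.compact).restrict Ω

theorem IsTestFunction.memLp_partialDeriv {d : ℕ} {Ω : Set (E d)} {φ : E d → ℝ}
    (hφ : IsTestFunction Ω φ) (i : Fin d) :
    MemLp (partialDeriv φ i) 2 (volume.restrict Ω) := by
  refine (Continuous.memLp_of_hasCompactSupport ?_ ?_).restrict Ω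
  · exact (hφ.smooth.continuous_fderiv (by simp)).clm_apply continuous_const
  · exact hφ.compact.fderiv_apply (𝕜 := ℝ) _

theorem memLp_coord {d : ℕ} {Ω : Set (E d)} (G : L2Vec Ω) (i : Fin d) :
    MemLp (fun x => G x i) 2 (volume.restrict Ω) :=
  (EuclideanSpace.proj (𝕜 := ℝ) i : E d →L[ℝ] ℝ).comp_memLp' (Lp.memLp G)

/-- The Hilbert space `H¹(Ω)`, realised as the space of pairs `(u, ∇u)` in `L²(Ω) × L²(Ω)^d`, where
`∇u` is the (almost everywhere unique) weak gradient of `u`. The norm inherited from the `ℓ²`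
product is `(‖u‖² + ‖∇u‖²)^{1/2}`, the usual one. -/
def H1 {d : ℕ} (Ω : Set (E d)) : Submodule ℝ (WithLp 2 (L2 Ω × L2Vec Ω)) where
  carrier := {w | IsWeakGradient Ω w.fst w.snd}
  zero_mem' := by
    intro φ _ i
    have h1 : ∀ᵐ x ∂volume.restrict Ω,
        (WithLp.fst (0 : WithLp 2 (L2 Ω × L2Vec Ω))) x * partialDeriv φ i x = 0 := by
      filter_upwards [Lp.coeFn_zero (E := ℝ) 2 (volume.restrict Ω)] with x hx
      rw [WithLp.zero_fst, hx]; simp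
    have h2 : ∀ᵐ x ∂volume.restrict Ω,
        (WithLp.snd (0 : WithLp 2 (L2 Ω × L2Vec Ω))) x i * φ x = 0 := by
      filter_upwards [Lp.coeFn_zero (E := E d) 2 (volume.restrict Ω)] with x hx
      rw [WithLp.zero_snd, hx]; simp
    rw [integral_eq_zero_of_ae h1, integral_eq_zero_of_ae h2, neg_zero]
  add_mem' := by
    intro v w hv hw φ hφ i
    have h1 : ∫ x in Ω, (WithLp.fst (v + w)) x * partialDeriv φ i x
        = ∫ x in Ω, (v.fst x * partialDeriv φ i x + w.fst x * partialDeriv φ i x) := by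
      refine integral_congr_ae ?_
      filter_upwards [Lp.coeFn_add v.fst w.fst] with x hx
      rw [WithLp.add_fst, hx, Pi.add_apply, add_mul]
    have h2 : ∫ x in Ω, (WithLp.snd (v + w)) x i * φ x
        = ∫ x in Ω, (v.snd x i * φ x + w.snd x i * φ x) := by
      refine integral_congr_ae ?_
      filter_upwards [Lp.coeFn_add v.snd w.snd] with x hx
      rw [WithLp.add_snd, hx, Pi.add_apply, PiLp.add_apply, add_mul]
    have i1 : ∀ y : L2 Ω, Integrable (fun x => y x * partialDeriv φ i x) (volume.restrict Ω) :=
      fun y => (Lp.memLp y).integrable_mul (hφ.memLp_partialDeriv i)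
    have i2 : ∀ y : L2Vec Ω, Integrable (fun x => y x i * φ x) (volume.restrict Ω) :=
      fun y => (memLp_coord y i).integrable_mul hφ.memLp
    rw [h1, h2, integral_add (i1 _) (i1 _), integral_add (i2 _) (i2 _), hv φ hφ i, hw φ hφ i]
    ring
  smul_mem' := by
    intro c w hw φ hφ i
    have h1 : ∫ x in Ω, (WithLp.fst (c • w)) x * partialDeriv φ i x
        = ∫ x in Ω, c * (w.fst x * partialDeriv φ i x) := by
      refine integral_congr_ae ?_
      filter_upwards [Lp.coeFn_smul c w.fst] with x hx
      rw [WithLp.smul_fst, hx, Pi.smul_apply, smul_eq_mul, mul_assoc]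
    have h2 : ∫ x in Ω, (WithLp.snd (c • w)) x i * φ x
        = ∫ x in Ω, c * (w.snd x i * φ x) := by
      refine integral_congr_ae ?_
      filter_upwards [Lp.coeFn_smul c w.snd] with x hx
      rw [WithLp.smul_snd, hx, Pi.smul_apply, PiLp.smul_apply, smul_eq_mul, mul_assoc]
    rw [h1, h2, integral_const_mul, integral_const_mul, hw φ hφ i]
    ring

/-- The function underlying an element of `H¹(Ω)`. -/
def toL2 {d : ℕ} {Ω : Set (E d)} (u : H1 Ω) : L2 Ω := (u : WithLp 2 (L2 Ω × L2Vec Ω)).fst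

/-- The weak gradient `∇u` of `u ∈ H¹(Ω)`. -/
def grad {d : ℕ} {Ω : Set (E d)} (u : H1 Ω) : L2Vec Ω :=
  (u : WithLp 2 (L2 Ω × L2Vec Ω)).snd

theorem IsTestFunction.zero {d : ℕ} (Ω : Set (E d)) : IsTestFunction Ω (0 : E d → ℝ) where
  smooth := contDiff_const
  compact := HasCompactSupport.zero
  support_subset := by
    rw [tsupport_eq_empty_iff.mpr rfl]
    exact Set.empty_subset _

theorem IsTestFunction.add {d : ℕ} {Ω : Set (E d)} {φ χ : E d → ℝ} (hφ : IsTestFunction Ω φ)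
    (hχ : IsTestFunction Ω χ) : IsTestFunction Ω (φ + χ) where
  smooth := hφ.smooth.add hχ.smooth
  compact := hφ.compact.add hχ.compact
  support_subset := (tsupport_add φ χ).trans (Set.union_subset hφ.support_subset hχ.support_subset)

theorem IsTestFunction.smul {d : ℕ} {Ω : Set (E d)} {φ : E d → ℝ} (c : ℝ)
    (hφ : IsTestFunction Ω φ) : IsTestFunction Ω (c • φ) where
  smooth := hφ.smooth.const_smul c
  compact := hφ.compact.mono' ((Function.support_const_smul_subset c φ).trans subset_closure)
  support_subset :=
    (closure_mono (Function.support_const_smul_subset c φ)).trans hφ.support_subset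

/-- `C_c^∞(Ω)` as a subspace of `H¹(Ω)`. -/
def testSubmodule {d : ℕ} (Ω : Set (E d)) : Submodule ℝ (H1 Ω) where
  carrier := {w | ∃ φ : E d → ℝ, IsTestFunction Ω φ ∧ toL2 w =ᵐ[volume.restrict Ω] φ}
  zero_mem' := ⟨0, IsTestFunction.zero Ω, Lp.coeFn_zero _ _ _⟩
  add_mem' := by
    rintro v w ⟨φ, hφ, hv⟩ ⟨χ, hχ, hw⟩
    exact ⟨φ + χ, hφ.add hχ, (Lp.coeFn_add (toL2 v) (toL2 w)).trans (hv.add hw)⟩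
  smul_mem' := by
    rintro c w ⟨φ, hφ, hw⟩
    exact ⟨c • φ, hφ.smul c, (Lp.coeFn_smul c (toL2 w)).trans (hw.const_smul c)⟩

/-- `H¹₀(Ω)`: the closure of `C_c^∞(Ω)` in `H¹(Ω)`. -/
def H10 {d : ℕ} (Ω : Set (E d)) : Submodule ℝ (H1 Ω) := (testSubmodule Ω).topologicalClosure

/-! ### Boundary values -/

/-- The surface measure on `Γ = ∂Ω`: the Hausdorff measure of dimension `d - 1`. -/
def surface {d : ℕ} (Ω : Set (E d)) : Measure (E d) :=
  (μH[(d : ℝ) - 1]).restrict (frontier Ω)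

/-- `u ∈ H¹(Ω)` has trace `g ∈ L²(Γ)`, written `u = g` on `Γ`: there are smooth functions `φ n`
on `ℝ^d` whose restrictions to `Ω` tend to `u` in `H¹(Ω)` and whose restrictions to `Γ` tend to `g`
in `L²(Γ)`. On a bounded Lipschitz domain this is the graph of the usual trace operator. -/
def HasTrace {d : ℕ} {Ω : Set (E d)} (u : H1 Ω) (g : Lp ℝ 2 (surface Ω)) : Prop :=
  ∃ (φ : ℕ → E d → ℝ) (v : ℕ → H1 Ω),
    (∀ n, ContDiff ℝ ∞ (φ n)) ∧ (∀ n, toL2 (v n) =ᵐ[volume.restrict Ω] φ n) ∧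
    Tendsto v atTop (𝓝 u) ∧
    Tendsto (fun n => eLpNorm (fun x => φ n x - g x) 2 (surface Ω)) atTop (𝓝 0)

/-- `H^{1/2}(Γ)`: the space of traces of functions in `H¹(Ω)`. -/
def HHalf {d : ℕ} (Ω : Set (E d)) : Set (Lp ℝ 2 (surface Ω)) := {g | ∃ u : H1 Ω, HasTrace u g}

/-! ### Matrices -/

/-- The Frobenius inner product `A · B`. -/
def frob {d : ℕ} (A B : Matrix (Fin d) (Fin d) ℝ) : ℝ := ∑ i, ∑ j, A i j * B i j

/-- The matrix `M` acting on a vector. -/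
def act {d : ℕ} (M : Matrix (Fin d) (Fin d) ℝ) (v : E d) : E d := Matrix.toEuclideanLin M v

/-- The symmetrized tensor product `(a ⊗ b)_{ij} = (a_i b_j + a_j b_i) / 2`. -/
def symTensor {d : ℕ} (a b : E d) : Matrix (Fin d) (Fin d) ℝ :=
  Matrix.of fun i j => (a i * b j + a j * b i) / 2

/-- `K = {A ∈ 𝒮_d | α I ≤ A ≤ β I}`, where `A ≤ B` means that `B - A` is symmetric positive
semidefinite. -/
def K (d : ℕ) (α β : ℝ) : Set (Matrix (Fin d) (Fin d) ℝ) :=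
  {A | A.IsSymm ∧ (A - α • (1 : Matrix (Fin d) (Fin d) ℝ)).PosSemidef ∧
    (β • (1 : Matrix (Fin d) (Fin d) ℝ) - A).PosSemidef}

/-- `P` is the orthogonal projection of `M` onto `K`, for the Frobenius inner product. -/
def IsProjK {d : ℕ} (α β : ℝ) (M P : Matrix (Fin d) (Fin d) ℝ) : Prop :=
  P ∈ K d α β ∧ ∀ B ∈ K d α β, frob (M - P) (B - P) ≤ 0

/-- The orthogonal projection `P_K` onto `K`. -/
def projK {d : ℕ} (α β : ℝ) (M : Matrix (Fin d) (Fin d) ℝ) : Matrix (Fin d) (Fin d) ℝ :=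
  Classical.epsilon (IsProjK α β M)

theorem mem_K_iff {d : ℕ} {α β : ℝ} {A : Matrix (Fin d) (Fin d) ℝ} :
    A ∈ K d α β ↔ A.IsSymm ∧ ∀ ξ : Fin d → ℝ,
      α * (ξ ⬝ᵥ ξ) ≤ ξ ⬝ᵥ A.mulVec ξ ∧ ξ ⬝ᵥ A.mulVec ξ ≤ β * (ξ ⬝ᵥ ξ) := by
  have hone : ∀ c : ℝ, (c • (1 : Matrix (Fin d) (Fin d) ℝ)).IsSymm := fun c =>
    Matrix.IsSymm.smul Matrix.isSymm_one c
  unfold K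
  simp only [Set.mem_ofPred_eq, Matrix.posSemidef_iff_dotProduct_mulVec, star_trivial,
    Matrix.sub_mulVec, Matrix.smul_mulVec, Matrix.one_mulVec, dotProduct_sub, dotProduct_smul,
    smul_eq_mul, sub_nonneg, Matrix.IsHermitian, Matrix.conjTranspose_eq_transpose_of_trivial]
  constructor
  · rintro ⟨hs, ⟨-, h1⟩, -, h2⟩
    exact ⟨hs, fun ξ => ⟨h1 ξ, h2 ξ⟩⟩
  · rintro ⟨hs, h⟩
    exact ⟨hs, ⟨hs.sub (hone α), fun ξ => (h ξ).1⟩, (hone β).sub hs, fun ξ => (h ξ).2⟩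

/-- The defining property of `P_K`: `P_K(M) ∈ K` and `(M - P_K(M)) · (B - P_K(M)) ≤ 0` for all
`B ∈ K`. -/
theorem isProjK_projK {d : ℕ} {α β : ℝ} (hαβ : α ≤ β) (M : Matrix (Fin d) (Fin d) ℝ) :
    IsProjK α β M (projK α β M) := by
  apply Classical.epsilon_spec (p := IsProjK α β M)
  let T : EuclideanSpace ℝ (Fin d × Fin d) → Matrix (Fin d) (Fin d) ℝ :=
    fun v => Matrix.of fun i j => v (i, j)
  let S : Matrix (Fin d) (Fin d) ℝ → EuclideanSpace ℝ (Fin d × Fin d) :=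
    fun A => WithLp.toLp 2 fun q => A q.1 q.2
  have hTS : ∀ A, T (S A) = A := fun A => rfl
  have hTc : Continuous T := by
    refine continuous_matrix fun i j => ?_
    exact (EuclideanSpace.proj (𝕜 := ℝ) (i, j)).continuous
  have hne : (T ⁻¹' K d α β).Nonempty := by
    refine ⟨S (α • 1), ?_⟩
    rw [Set.mem_preimage, hTS, mem_K_iff]
    refine ⟨Matrix.IsSymm.smul Matrix.isSymm_one α, fun ξ => ?_⟩
    have h0 : 0 ≤ ξ ⬝ᵥ ξ := Finset.sum_nonneg fun i _ => mul_self_nonneg (ξ i)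
    simp only [Matrix.smul_mulVec, Matrix.one_mulVec, dotProduct_smul, smul_eq_mul, le_refl,
      true_and]
    exact mul_le_mul_of_nonneg_right hαβ h0
  have hcl : IsClosed (K d α β) := by
    have : K d α β = {A | A.transpose = A} ∩ ⋂ ξ : Fin d → ℝ,
        ({A | α * (ξ ⬝ᵥ ξ) ≤ ξ ⬝ᵥ A.mulVec ξ} ∩ {A | ξ ⬝ᵥ A.mulVec ξ ≤ β * (ξ ⬝ᵥ ξ)}) := by
      ext A
      simp only [mem_K_iff, Matrix.IsSymm, Set.mem_inter_iff, Set.mem_ofPred_eq, Set.mem_iInter]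
    rw [this]
    have hq : ∀ ξ : Fin d → ℝ,
        Continuous fun A : Matrix (Fin d) (Fin d) ℝ => ξ ⬝ᵥ A.mulVec ξ := by
      intro ξ
      exact continuous_const.dotProduct (continuous_id.matrix_mulVec continuous_const)
    refine (isClosed_eq continuous_id.matrix_transpose continuous_id).inter
      (isClosed_iInter fun ξ => ?_)
    exact (isClosed_le continuous_const (hq ξ)).inter (isClosed_le (hq ξ) continuous_const)
  have hconv : Convex ℝ (T ⁻¹' K d α β) := by
    intro v hv w hw a b ha hb hab
    rw [Set.mem_preimage, mem_K_iff] at hv hw ⊢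
    have hT : T (a • v + b • w) = a • T v + b • T w := rfl
    rw [hT]
    refine ⟨(hv.1.smul a).add (hw.1.smul b), fun ξ => ?_⟩
    obtain ⟨h1, h2⟩ := hv.2 ξ
    obtain ⟨h3, h4⟩ := hw.2 ξ
    simp only [Matrix.add_mulVec, Matrix.smul_mulVec, dotProduct_add, dotProduct_smul, smul_eq_mul]
    have e : ∀ c : ℝ, c * (ξ ⬝ᵥ ξ) = a * (c * (ξ ⬝ᵥ ξ)) + b * (c * (ξ ⬝ᵥ ξ)) := by
      intro c
      rw [← add_mul, hab, one_mul]
    rw [e α, e β]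
    exact ⟨add_le_add (mul_le_mul_of_nonneg_left h1 ha) (mul_le_mul_of_nonneg_left h3 hb),
      add_le_add (mul_le_mul_of_nonneg_left h2 ha) (mul_le_mul_of_nonneg_left h4 hb)⟩
  obtain ⟨v, hv, hmin⟩ := exists_norm_eq_iInf_of_complete_convex hne
    (hcl.preimage hTc).isComplete hconv (S M)
  rw [norm_eq_iInf_iff_real_inner_le_zero hconv hv] at hmin
  refine ⟨T v, hv, fun B hB => ?_⟩
  have := hmin (S B) (by rwa [Set.mem_preimage, hTS])
  rw [PiLp.inner_apply, Fintype.sum_prod_type] at this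
  refine le_of_eq_of_le ?_ this
  refine Finset.sum_congr rfl fun i _ => Finset.sum_congr rfl fun j _ => ?_
  simp [T, S, mul_comm]

/-! ### The regularized inverse problem -/

/-- The admissible set `𝒜`: essentially bounded matrix fields on `Ω` that are almost everywhere
symmetric with `α |ξ|² ≤ ∑ A_ij ξ_i ξ_j ≤ β |ξ|²` for all `ξ`. -/
def Admissible {d : ℕ} (Ω : Set (E d)) (α β : ℝ) : Set (E d → Matrix (Fin d) (Fin d) ℝ) :=
  {A | (∀ i j, MemLp (fun x => A x i j) ∞ (volume.restrict Ω)) ∧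
    ∀ᵐ x ∂volume.restrict Ω, (A x).IsSymm ∧ ∀ ξ : E d,
      α * ‖ξ‖ ^ 2 ≤ ∑ i, ∑ j, A x i j * ξ i * ξ j ∧
        ∑ i, ∑ j, A x i j * ξ i * ξ j ≤ β * ‖ξ‖ ^ 2}

/-- `u ∈ H¹(Ω)` is the weak solution of `-div(A ∇u) = f` in `Ω`, `u = g` on `Γ`. -/
def IsState {d : ℕ} {Ω : Set (E d)} (A : E d → Matrix (Fin d) (Fin d) ℝ)
    (f : StrongDual ℝ (H1 Ω)) (g : Lp ℝ 2 (surface Ω)) (u : H1 Ω) : Prop :=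
  HasTrace u g ∧ ∀ v ∈ H10 Ω, ∫ x in Ω, inner ℝ (act (A x) (grad u x)) (grad v x) = f v

/-- `p ∈ H¹₀(Ω)` is the weak solution of `-div(A ∇p) = div(A (A ∇u - h))` in `Ω`,
`p = 0` on `Γ`. -/
def IsAdjoint {d : ℕ} {Ω : Set (E d)} (A : E d → Matrix (Fin d) (Fin d) ℝ) (h : L2Vec Ω)
    (u p : H1 Ω) : Prop :=
  p ∈ H10 Ω ∧ ∀ v ∈ H10 Ω, ∫ x in Ω, inner ℝ (act (A x) (grad p x)) (grad v x) =
    - ∫ x in Ω, inner ℝ (act (A x) (act (A x) (grad u x) - h x)) (grad v x)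

/-- The value `½ ∑_ℓ ‖A ∇u^ℓ - h^ℓ‖² + (γ/2) ‖A‖²` of the Tikhonov functional at the matrix field
`A` with states `u^ℓ`. -/
def tikhonov {d L : ℕ} {Ω : Set (E d)} (γ : ℝ) (h : Fin L → L2Vec Ω)
    (A : E d → Matrix (Fin d) (Fin d) ℝ) (u : Fin L → H1 Ω) : ℝ :=
  1 / 2 * ∑ ℓ, (∫ x in Ω, ‖act (A x) (grad (u ℓ) x) - h ℓ x‖ ^ 2) +
    γ / 2 * ∫ x in Ω, frob (A x) (A x)

/-- `A` minimizes `J_γ` over the admissible set, where `J_γ(B)` is the value of the Tikhonov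
functional at `B` and the states `u^ℓ(B)` that belong to `B`. -/
def IsMinimizer {d L : ℕ} {Ω : Set (E d)} (α β γ : ℝ) (f : Fin L → StrongDual ℝ (H1 Ω))
    (g : Fin L → Lp ℝ 2 (surface Ω)) (h : Fin L → L2Vec Ω)
    (A : E d → Matrix (Fin d) (Fin d) ℝ) : Prop :=
  A ∈ Admissible Ω α β ∧ ∀ B ∈ Admissible Ω α β, ∀ u w : Fin L → H1 Ω,
    (∀ ℓ, IsState A (f ℓ) (g ℓ) (u ℓ)) → (∀ ℓ, IsState B (f ℓ) (g ℓ) (w ℓ)) →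
      tikhonov γ h A u ≤ tikhonov γ h B w

end

end AnisotropicConductivity

open AnisotropicConductivity

namespace AnisotropicConductivity

noncomputable section

/-! ### Completeness and the Poincaré inequality -/

/-! Since `K` is convex, the segment from the minimizer `A` to any admissible `B` stays admissible.
Put `H = B - A`. The state of `A + tH` is `u + z`, where `z ∈ H¹₀` solves the perturbed equation
with right-hand side `div(t H∇u)`. Ellipticity with the constant `α`, valid along the whole segment,
gives `‖∇z‖ ≤ t‖H∇u‖/α`. In the expansion of the misfit, the term `⟨A∇z, A∇u - h⟩` still involves
the unknown `z`; the adjoint equation tested with `z`, and the equation of `z` tested with `p`, turn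
it into `t⟨H∇u, ∇p⟩ + O(t²)` (`misfit_expansion`, `exists_isState_segment`). Minimality, division by
`t` and `t → 0` then give `0 ≤ ∫ G·(B - A)`, where `G` is `tikhonovGradient`. No differentiability
of the map from coefficients to states is needed.

The inequality is localized with competitors equal to a constant `M ∈ K` on a measurable set and to
`A` elsewhere (`ae_forall_frob_nonneg`): almost everywhere `G(x)·(M - A(x)) ≥ 0` for all `M ∈ K`.
This is the obtuse-angle characterization of `A(x)` as the projection of `A(x) - λG(x)`. States and
adjoints exist by Lax–Milgram on `H¹₀`, where Poincaré's inequality gives coercivity. -/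

/-- The `i`-th component of a square integrable vector field. -/
def coord {d : ℕ} {Ω : Set (E d)} (i : Fin d) : L2Vec Ω →L[ℝ] L2 Ω :=
  (EuclideanSpace.proj (𝕜 := ℝ) i : E d →L[ℝ] ℝ).compLpL 2 (volume.restrict Ω)

theorem coeFn_coord {d : ℕ} {Ω : Set (E d)} (i : Fin d) (G : L2Vec Ω) :
    coord i G =ᵐ[volume.restrict Ω] fun x => G x i :=
  ContinuousLinearMap.coeFn_compLpL _ _

theorem norm_coord_le {d : ℕ} {Ω : Set (E d)} (i : Fin d) (G : L2Vec Ω) :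
    ‖coord i G‖ ≤ ‖G‖ := by
  refine Lp.norm_le_norm_of_ae_le ?_
  filter_upwards [coeFn_coord i G] with x hx
  rw [hx]
  exact PiLp.norm_apply_le (G x) i

/-- Each weak-gradient identity equates two continuous functionals of the pair, namely inner
products with fixed `L²` functions. The resulting completeness is what Lax–Milgram requires. -/
theorem isClosed_H1 {d : ℕ} (Ω : Set (E d)) :
    IsClosed (H1 Ω : Set (WithLp 2 (L2 Ω × L2Vec Ω))) := by
  have key : (H1 Ω : Set (WithLp 2 (L2 Ω × L2Vec Ω))) =
      ⋂ (φ : E d → ℝ) (hφ : IsTestFunction Ω φ) (i : Fin d),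
        {w | inner ℝ ((hφ.memLp_partialDeriv i).toLp) w.fst =
          - inner ℝ (hφ.memLp.toLp) (coord i w.snd)} := by
    ext w
    simp only [Set.mem_iInter]
    refine forall_congr' fun φ => forall_congr' fun hφ => forall_congr' fun i => ?_
    rw [Set.mem_ofPred_eq, L2.inner_def, L2.inner_def]
    have h1 : ∫ x in Ω, inner ℝ ((hφ.memLp_partialDeriv i).toLp _ x) (w.fst x) =
        ∫ x in Ω, w.fst x * partialDeriv φ i x := by
      refine integral_congr_ae ?_
      filter_upwards [(hφ.memLp_partialDeriv i).coeFn_toLp] with x hx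
      rw [hx]
      rfl
    have h2 : ∫ x in Ω, inner ℝ (hφ.memLp.toLp _ x) (coord i w.snd x) =
        ∫ x in Ω, w.snd x i * φ x := by
      refine integral_congr_ae ?_
      filter_upwards [hφ.memLp.coeFn_toLp, coeFn_coord i w.snd] with x hx hx'
      rw [hx, hx']
      rfl
    rw [h1, h2]
  rw [key]
  refine isClosed_iInter fun φ => isClosed_iInter fun hφ => isClosed_iInter fun i => ?_
  refine isClosed_eq ?_ ?_
  · exact continuous_const.inner (WithLp.prod_continuous_ofLp 2 _ _).fst
  · exact (continuous_const.inner
      ((coord i).continuous.comp (WithLp.prod_continuous_ofLp 2 _ _).snd)).neg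

instance completeSpace_H1 {d : ℕ} (Ω : Set (E d)) : CompleteSpace (H1 Ω) :=
  (isClosed_H1 Ω).completeSpace_coe

instance completeSpace_H10 {d : ℕ} (Ω : Set (E d)) : CompleteSpace (H10 Ω) :=
  (Submodule.isClosed_topologicalClosure (testSubmodule Ω)).completeSpace_coe

/-- The gradient as a bounded operator from `H¹(Ω)` to `L²(Ω)^d`. -/
def gradL {d : ℕ} (Ω : Set (E d)) : H1 Ω →L[ℝ] L2Vec Ω :=
  (WithLp.sndL 2 ℝ (L2 Ω) (L2Vec Ω)).comp (H1 Ω).subtypeL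

@[simp] theorem gradL_apply {d : ℕ} {Ω : Set (E d)} (u : H1 Ω) : gradL Ω u = grad u := rfl

/-- The inclusion of `H¹(Ω)` in `L²(Ω)`. -/
def toL2L {d : ℕ} (Ω : Set (E d)) : H1 Ω →L[ℝ] L2 Ω :=
  (WithLp.fstL 2 ℝ (L2 Ω) (L2Vec Ω)).comp (H1 Ω).subtypeL

@[simp] theorem toL2L_apply {d : ℕ} {Ω : Set (E d)} (u : H1 Ω) : toL2L Ω u = toL2 u := rfl

theorem norm_sq_H1 {d : ℕ} {Ω : Set (E d)} (u : H1 Ω) :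
    ‖u‖ ^ 2 = ‖toL2 u‖ ^ 2 + ‖grad u‖ ^ 2 :=
  WithLp.prod_norm_sq_eq_of_L2 (u : WithLp 2 (L2 Ω × L2Vec Ω))

theorem IsTestFunction.coord_mul {d : ℕ} {Ω : Set (E d)} {φ : E d → ℝ}
    (hφ : IsTestFunction Ω φ) (i : Fin d) : IsTestFunction Ω (fun x => x i * φ x) where
  smooth := (EuclideanSpace.proj (𝕜 := ℝ) i : E d →L[ℝ] ℝ).contDiff.mul hφ.smooth
  compact := hφ.compact.mul_left
  support_subset := (tsupport_mul_subset_right).trans hφ.support_subset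

theorem partialDeriv_coord_mul {d : ℕ} {φ : E d → ℝ} (hφ : ContDiff ℝ ∞ φ) (i : Fin d) (x : E d) :
    partialDeriv (fun x => x i * φ x) i x = φ x + x i * partialDeriv φ i x := by
  have h1 : HasFDerivAt (fun x : E d => x i) (EuclideanSpace.proj (𝕜 := ℝ) i : E d →L[ℝ] ℝ) x :=
    (EuclideanSpace.proj (𝕜 := ℝ) i : E d →L[ℝ] ℝ).hasFDerivAt
  have h2 := (hφ.differentiable (by simp) x).hasFDerivAt
  unfold partialDeriv
  have h3 := (h1.mul h2).fderiv
  change fderiv ℝ (fun x : E d => x i * φ x) x = _ at h3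
  rw [h3]
  simp
  ring

/-- Let `I = ∫ φ ∂ᵢ(xᵢφ)` and `J = ∫ (∂ᵢφ) xᵢφ`. The product rule gives `I = ∫ φ² + J`, integration
by parts gives `I = -J`; add the two. -/
theorem IsTestFunction.setIntegral_mul_partialDeriv {d : ℕ} {Ω : Set (E d)} {φ : E d → ℝ}
    (hφ : IsTestFunction Ω φ) (i : Fin d) :
    2 * ∫ x in Ω, φ x * partialDeriv (fun x => x i * φ x) i x = ∫ x in Ω, φ x * φ x := by
  have hψ := hφ.coord_mul i
  have hcont : ∀ {χ : E d → ℝ}, IsTestFunction Ω χ → Continuous (partialDeriv χ i) := fun hχ =>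
    (hχ.smooth.continuous_fderiv (by simp)).clm_apply continuous_const
  have i1 : Integrable (fun x => φ x * partialDeriv (fun x => x i * φ x) i x) :=
    (hφ.smooth.continuous.mul (hcont hψ)).integrable_of_hasCompactSupport hφ.compact.mul_right
  have i2 : Integrable (fun x => partialDeriv φ i x * (x i * φ x)) :=
    ((hcont hφ).mul hψ.smooth.continuous).integrable_of_hasCompactSupport hψ.compact.mul_left
  have i3 : Integrable (fun x => φ x * (x i * φ x)) :=
    (hφ.smooth.continuous.mul hψ.smooth.continuous).integrable_of_hasCompactSupport
      hφ.compact.mul_right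
  have i4 : Integrable (fun x => φ x * φ x) :=
    (hφ.smooth.continuous.mul hφ.smooth.continuous).integrable_of_hasCompactSupport
      hφ.compact.mul_right
  have hz : ∀ x, x ∉ Ω → φ x = 0 := fun x hx =>
    image_eq_zero_of_notMem_tsupport fun h => hx (hφ.support_subset h)
  rw [setIntegral_eq_integral_of_forall_compl_eq_zero fun x hx => by rw [hz x hx, zero_mul],
    setIntegral_eq_integral_of_forall_compl_eq_zero fun x hx => by rw [hz x hx, zero_mul]]
  have hparts := integral_mul_fderiv_eq_neg_fderiv_mul_of_integrable
    (μ := (volume : Measure (E d))) (v := EuclideanSpace.single i 1) i2 i1 i3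
    (fun x _ => hφ.smooth.differentiable (by simp) x)
    (fun x _ => hψ.smooth.differentiable (by simp) x)
  have hsum : ∫ x, φ x * partialDeriv (fun x => x i * φ x) i x =
      (∫ x, φ x * φ x) + ∫ x, partialDeriv φ i x * (x i * φ x) := by
    rw [← integral_add i4 i2]
    refine integral_congr_ae (.of_forall fun x => ?_)
    simp only [partialDeriv_coord_mul hφ.smooth]
    ring
  change ∫ x, φ x * partialDeriv (fun x => x i * φ x) i x =
    - ∫ x, partialDeriv φ i x * (x i * φ x) at hparts
  linarith

/-- Poincaré's inequality on `C_c^∞(Ω)`, `Ω` bounded in the direction of a coordinate. -/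
theorem norm_toL2_le_of_mem_testSubmodule {d : ℕ} {Ω : Set (E d)} (hm : MeasurableSet Ω)
    {R : ℝ} (hR0 : 0 ≤ R) (i : Fin d) (hR : ∀ x ∈ Ω, |x i| ≤ R) {w : H1 Ω} (hw : w ∈ testSubmodule Ω) :
    ‖toL2 w‖ ≤ 2 * R * ‖grad w‖ := by
  obtain ⟨φ, hφ, hwφ⟩ := hw
  have hψ := hφ.coord_mul i
  -- Testing the weak gradient against `xᵢφ` yields `‖w‖² = -2 ∫ (∂ᵢw) xᵢφ ≤ 2R‖w‖‖∇w‖`, without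
  -- identifying the weak gradient of `w` with the classical one of `φ`.
  have hweak := w.2 _ hψ i
  have h1 : ∫ x in Ω, toL2 w x * partialDeriv (fun x => x i * φ x) i x =
      ∫ x in Ω, φ x * partialDeriv (fun x => x i * φ x) i x := by
    refine integral_congr_ae ?_
    filter_upwards [hwφ] with x hx
    rw [hx]
  have h2 : ‖toL2 w‖ ^ 2 = ∫ x in Ω, φ x * φ x := by
    rw [← real_inner_self_eq_norm_sq, L2.inner_def]
    refine integral_congr_ae ?_
    filter_upwards [hwφ] with x hx
    rw [hx]
    rfl
  have h3 : ∫ x in Ω, grad w x i * (x i * φ x) = inner ℝ (hψ.memLp.toLp) (coord i (grad w)) := by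
    rw [L2.inner_def]
    refine integral_congr_ae ?_
    filter_upwards [hψ.memLp.coeFn_toLp, coeFn_coord i (grad w)] with x hx hx'
    rw [hx, hx']
    rfl
  have h4 : ‖(hψ.memLp.toLp : L2 Ω)‖ ≤ R * ‖toL2 w‖ := by
    refine Lp.norm_le_mul_norm_of_ae_le_mul ?_
    filter_upwards [hψ.memLp.coeFn_toLp, hwφ, ae_restrict_mem hm] with x hx hx' hxΩ
    rw [hx, hx', norm_mul]
    exact mul_le_mul_of_nonneg_right (hR x hxΩ) (norm_nonneg _)
  have h5 := abs_real_inner_le_norm (hψ.memLp.toLp : L2 Ω) (coord i (grad w))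
  have h6 : ‖toL2 w‖ ^ 2 ≤ 2 * (R * ‖toL2 w‖ * ‖grad w‖) := by
    have h7 := hφ.setIntegral_mul_partialDeriv i
    change ∫ x in Ω, toL2 w x * partialDeriv (fun x => x i * φ x) i x =
      - ∫ x in Ω, grad w x i * (x i * φ x) at hweak
    have h8 := mul_le_mul h4 (norm_coord_le i (grad w)) (norm_nonneg _)
      ((norm_nonneg _).trans h4)
    rw [h2, ← h7, ← h1, hweak, h3]
    have h9 := neg_abs_le (inner ℝ (hψ.memLp.toLp : L2 Ω) (coord i (grad w)))
    linarith
  rcases (norm_nonneg (toL2 w)).eq_or_lt with h0 | h0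
  · rw [← h0]
    positivity
  · nlinarith

theorem norm_toL2_le_of_mem_H10 {d : ℕ} {Ω : Set (E d)} (hm : MeasurableSet Ω)
    {R : ℝ} (hR0 : 0 ≤ R) (i : Fin d) (hR : ∀ x ∈ Ω, |x i| ≤ R) {w : H1 Ω} (hw : w ∈ H10 Ω) :
    ‖toL2 w‖ ≤ 2 * R * ‖grad w‖ := by
  have hcl : IsClosed {w : H1 Ω | ‖toL2L Ω w‖ ≤ 2 * R * ‖gradL Ω w‖} :=
    isClosed_le (by fun_prop) (by fun_prop)
  exact closure_minimal
    (fun v hv => norm_toL2_le_of_mem_testSubmodule hm hR0 i hR hv) hcl hw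

/-- On `H¹₀(Ω)` the norm of the gradient controls the `H¹` norm. -/
theorem exists_norm_sq_le_grad {d : ℕ} (hd : 0 < d) {Ω : Set (E d)} (hm : MeasurableSet Ω)
    (hb : Bornology.IsBounded Ω) :
    ∃ C : ℝ, 0 < C ∧ ∀ w ∈ H10 Ω, ‖w‖ ^ 2 ≤ C * ‖grad w‖ ^ 2 := by
  obtain ⟨R, hR0, hR⟩ := hb.exists_pos_norm_le
  refine ⟨(2 * R) ^ 2 + 1, by positivity, fun w hw => ?_⟩
  have h := norm_toL2_le_of_mem_H10 hm hR0.le ⟨0, hd⟩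
    (fun x hx => (PiLp.norm_apply_le x _).trans (hR x hx)) hw
  have h2 := pow_le_pow_left₀ (norm_nonneg _) h 2
  rw [norm_sq_H1]
  nlinarith

/-! ### Matrix fields as multiplication operators -/

theorem act_apply {d : ℕ} (M : Matrix (Fin d) (Fin d) ℝ) (v : E d) (i : Fin d) :
    act M v i = ∑ j, M i j * v j := rfl

theorem act_add_left {d : ℕ} (M N : Matrix (Fin d) (Fin d) ℝ) (v : E d) :
    act (M + N) v = act M v + act N v := by
  simp [act]

theorem act_smul_left {d : ℕ} (c : ℝ) (M : Matrix (Fin d) (Fin d) ℝ) (v : E d) :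
    act (c • M) v = c • act M v := by
  simp [act]

theorem inner_act {d : ℕ} (M : Matrix (Fin d) (Fin d) ℝ) (v w : E d) :
    inner ℝ (act M v) w = ∑ i, ∑ j, M i j * v j * w i := by
  rw [PiLp.inner_apply]
  refine Finset.sum_congr rfl fun i _ => ?_
  rw [act_apply, real_inner_comm]
  exact Finset.sum_mul ..

theorem inner_act_comm {d : ℕ} {M : Matrix (Fin d) (Fin d) ℝ} (hM : M.IsSymm) (v w : E d) :
    inner ℝ (act M v) w = inner ℝ v (act M w) := by
  rw [real_inner_comm (act M w), inner_act, inner_act, Finset.sum_comm]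
  refine Finset.sum_congr rfl fun i _ => Finset.sum_congr rfl fun j _ => ?_
  rw [hM.apply]
  ring

/-- A symmetric matrix does not see the antisymmetric part of `a bᵀ`. This puts the directional
derivative, taken along symmetric fields, in the form of a pairing with a symmetric gradient. -/
theorem frob_symTensor {d : ℕ} (a b : E d) {M : Matrix (Fin d) (Fin d) ℝ} (hM : M.IsSymm) :
    frob (symTensor a b) M = inner ℝ (act M a) b := by
  have h1 : frob (symTensor a b) M =
      (∑ i, ∑ j, M i j * a j * b i + ∑ i, ∑ j, M i j * a i * b j) / 2 := by
    rw [← Finset.sum_add_distrib, Finset.sum_div]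
    refine Finset.sum_congr rfl fun i _ => ?_
    rw [← Finset.sum_add_distrib, Finset.sum_div]
    refine Finset.sum_congr rfl fun j _ => ?_
    simp only [symTensor, Matrix.of_apply]
    ring
  have h2 : ∑ i, ∑ j, M i j * a i * b j = ∑ i, ∑ j, M i j * a j * b i := by
    rw [Finset.sum_comm]
    refine Finset.sum_congr rfl fun i _ => Finset.sum_congr rfl fun j _ => ?_
    rw [hM.apply]
  rw [h1, h2, inner_act]
  ring

/-- A matrix field with essentially bounded entries. -/
abbrev BddField {d : ℕ} (Ω : Set (E d)) (A : E d → Matrix (Fin d) (Fin d) ℝ) : Prop :=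
  ∀ i j, MemLp (fun x => A x i j) ∞ (volume.restrict Ω)

theorem memLp_sum_smul {ι X F : Type*} [MeasurableSpace X] {μ : Measure X}
    [NormedAddCommGroup F] [NormedSpace ℝ F] (s : Finset ι) {c : ι → X → ℝ} (T : ι → F)
    (hc : ∀ i ∈ s, MemLp (c i) ∞ μ) : MemLp (fun x => ∑ i ∈ s, c i x • T i) ∞ μ :=
  memLp_finsetSum s fun i hi =>
    (ContinuousLinearMap.toSpanSingleton ℝ (T i)).comp_memLp' (hc i hi)

/-- Expanding in matrix units reduces measurability and essential boundedness of the operator-valued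
map to those of the entries. -/
theorem memLp_toEuclideanCLM {d : ℕ} {Ω : Set (E d)} {A : E d → Matrix (Fin d) (Fin d) ℝ}
    (hA : BddField Ω A) :
    MemLp (fun x => Matrix.toEuclideanCLM (𝕜 := ℝ) (A x)) ∞ (volume.restrict Ω) := by
  have h : (fun x => Matrix.toEuclideanCLM (𝕜 := ℝ) (A x)) = fun x =>
      ∑ q : Fin d × Fin d, A x q.1 q.2 • Matrix.toEuclideanCLM (𝕜 := ℝ)
        (Matrix.single q.1 q.2 (1 : ℝ)) := by
    funext x
    conv_lhs => rw [Matrix.matrix_eq_sum_single (A x)]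
    simp only [map_sum, ← map_smul, Matrix.smul_single, smul_eq_mul, mul_one,
      Fintype.sum_prod_type]
  rw [h]
  exact memLp_sum_smul Finset.univ _ fun q _ => hA q.1 q.2

/-- Multiplication of a square integrable vector field by a bounded matrix field. -/
def multiplier {d : ℕ} {Ω : Set (E d)} {A : E d → Matrix (Fin d) (Fin d) ℝ}
    (hA : BddField Ω A) : L2Vec Ω →L[ℝ] L2Vec Ω :=
  (ContinuousLinearMap.id ℝ (E d →L[ℝ] E d)).holderL (volume.restrict Ω) ∞ 2 2
    ((memLp_toEuclideanCLM hA).toLp)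

theorem coeFn_multiplier {d : ℕ} {Ω : Set (E d)} {A : E d → Matrix (Fin d) (Fin d) ℝ}
    (hA : BddField Ω A) (G : L2Vec Ω) :
    multiplier hA G =ᵐ[volume.restrict Ω] fun x => act (A x) (G x) := by
  filter_upwards [(ContinuousLinearMap.id ℝ (E d →L[ℝ] E d)).coeFn_holder (r := 2)
    ((memLp_toEuclideanCLM hA).toLp) G, (memLp_toEuclideanCLM hA).coeFn_toLp] with x hx hx'
  rw [hx'] at hx
  exact hx

theorem BddField.add {d : ℕ} {Ω : Set (E d)} {A B : E d → Matrix (Fin d) (Fin d) ℝ}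
    (hA : BddField Ω A) (hB : BddField Ω B) : BddField Ω (fun x => A x + B x) :=
  fun i j => (hA i j).add (hB i j)

theorem BddField.sub {d : ℕ} {Ω : Set (E d)} {A B : E d → Matrix (Fin d) (Fin d) ℝ}
    (hA : BddField Ω A) (hB : BddField Ω B) : BddField Ω (fun x => A x - B x) :=
  fun i j => (hA i j).sub (hB i j)

theorem BddField.smul {d : ℕ} {Ω : Set (E d)} {A : E d → Matrix (Fin d) (Fin d) ℝ}
    (hA : BddField Ω A) (c : ℝ) : BddField Ω (fun x => c • A x) :=
  fun i j => (hA i j).const_smul c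

/-- Lets the variation in `t` be computed with bounded operators on `L²`, as an affine perturbation.
-/
theorem multiplier_add_smul {d : ℕ} {Ω : Set (E d)} {A B : E d → Matrix (Fin d) (Fin d) ℝ}
    (hA : BddField Ω A) (hB : BddField Ω B) (t : ℝ) (G : L2Vec Ω) :
    multiplier (hA.add (hB.smul t)) G = multiplier hA G + t • multiplier hB G := by
  refine Lp.ext ?_
  filter_upwards [coeFn_multiplier (hA.add (hB.smul t)) G, coeFn_multiplier hA G,
    coeFn_multiplier hB G, Lp.coeFn_add (multiplier hA G) (t • multiplier hB G),
    Lp.coeFn_smul t (multiplier hB G)] with x h1 h2 h3 h4 h5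
  rw [h1, h4, Pi.add_apply, h5, Pi.smul_apply, h2, h3, act_add_left, act_smul_left]

theorem inner_multiplier {d : ℕ} {Ω : Set (E d)} {A : E d → Matrix (Fin d) (Fin d) ℝ}
    (hA : BddField Ω A) (G F : L2Vec Ω) :
    inner ℝ (multiplier hA G) F = ∫ x in Ω, inner ℝ (act (A x) (G x)) (F x) := by
  rw [L2.inner_def]
  refine integral_congr_ae ?_
  filter_upwards [coeFn_multiplier hA G] with x hx
  rw [hx]

theorem integrable_inner_act {d : ℕ} {Ω : Set (E d)} {A : E d → Matrix (Fin d) (Fin d) ℝ}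
    (hA : BddField Ω A) (G F : L2Vec Ω) :
    Integrable (fun x => inner ℝ (act (A x) (G x)) (F x)) (volume.restrict Ω) := by
  refine (L2.integrable_inner (𝕜 := ℝ) (multiplier hA G) F).congr ?_
  filter_upwards [coeFn_multiplier hA G] with x hx
  rw [hx]

theorem Admissible.bddField {d : ℕ} {Ω : Set (E d)} {α β : ℝ}
    {A : E d → Matrix (Fin d) (Fin d) ℝ} (hA : A ∈ Admissible Ω α β) : BddField Ω A := hA.1

theorem Admissible.ae_isSymm {d : ℕ} {Ω : Set (E d)} {α β : ℝ}
    {A : E d → Matrix (Fin d) (Fin d) ℝ} (hA : A ∈ Admissible Ω α β) :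
    ∀ᵐ x ∂volume.restrict Ω, (A x).IsSymm := hA.2.mono fun _ h => h.1

theorem inner_multiplier_comm {d : ℕ} {Ω : Set (E d)} {A : E d → Matrix (Fin d) (Fin d) ℝ}
    (hA : BddField Ω A) (hs : ∀ᵐ x ∂volume.restrict Ω, (A x).IsSymm) (G F : L2Vec Ω) :
    inner ℝ (multiplier hA G) F = inner ℝ G (multiplier hA F) := by
  rw [real_inner_comm (multiplier hA F), inner_multiplier, inner_multiplier]
  refine integral_congr_ae ?_
  filter_upwards [hs] with x hx
  rw [inner_act_comm hx, real_inner_comm]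

/-- The constant `α` is the same for all admissible fields, which makes the estimates along a
segment uniform in `t`. -/
theorem Admissible.le_inner_multiplier {d : ℕ} {Ω : Set (E d)} {α β : ℝ}
    {A : E d → Matrix (Fin d) (Fin d) ℝ} (hA : A ∈ Admissible Ω α β) (G : L2Vec Ω) :
    α * ‖G‖ ^ 2 ≤ inner ℝ (multiplier (Admissible.bddField hA) G) G := by
  rw [← real_inner_self_eq_norm_sq, inner_multiplier, L2.inner_def, ← integral_const_mul]
  refine integral_mono_ae ((L2.integrable_inner (𝕜 := ℝ) G G).const_mul α)
    (integrable_inner_act hA.1 G G) ?_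
  filter_upwards [hA.2] with x hx
  have h := (hx.2 (G x)).1
  rw [inner_act, real_inner_self_eq_norm_sq]
  refine h.trans (le_of_eq ?_)
  refine Finset.sum_congr rfl fun i _ => Finset.sum_congr rfl fun j _ => ?_
  ring

theorem ae_mem_K_of_admissible {d : ℕ} {Ω : Set (E d)} {α β : ℝ}
    {A : E d → Matrix (Fin d) (Fin d) ℝ} (hA : A ∈ Admissible Ω α β) :
    ∀ᵐ x ∂volume.restrict Ω, A x ∈ K d α β := by
  filter_upwards [hA.2] with x hx
  refine mem_K_iff.mpr ⟨hx.1, fun ξ => ?_⟩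
  have h := hx.2 (WithLp.toLp 2 ξ)
  have e1 : ‖(WithLp.toLp 2 ξ : E d)‖ ^ 2 = ξ ⬝ᵥ ξ := by
    rw [EuclideanSpace.real_norm_sq_eq]
    simp [dotProduct, sq]
  have e2 : ∑ i, ∑ j, A x i j * ξ i * ξ j = ξ ⬝ᵥ (A x).mulVec ξ := by
    simp only [dotProduct, Matrix.mulVec, Finset.mul_sum]
    refine Finset.sum_congr rfl fun i _ => Finset.sum_congr rfl fun j _ => ?_
    ring
  rwa [e1, show ∑ i, ∑ j, A x i j * (WithLp.toLp 2 ξ : E d) i * (WithLp.toLp 2 ξ : E d) j =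
    ξ ⬝ᵥ (A x).mulVec ξ from e2] at h

theorem admissible_of_ae_mem_K {d : ℕ} {Ω : Set (E d)} {α β : ℝ}
    {A : E d → Matrix (Fin d) (Fin d) ℝ} (hA : BddField Ω A)
    (hK : ∀ᵐ x ∂volume.restrict Ω, A x ∈ K d α β) : A ∈ Admissible Ω α β := by
  refine ⟨hA, ?_⟩
  filter_upwards [hK] with x hx
  obtain ⟨hs, h⟩ := mem_K_iff.mp hx
  refine ⟨hs, fun ξ => ?_⟩
  have e1 : ‖ξ‖ ^ 2 = ξ.ofLp ⬝ᵥ ξ.ofLp := by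
    rw [EuclideanSpace.real_norm_sq_eq]
    simp [dotProduct, sq]
  have e2 : ∑ i, ∑ j, A x i j * ξ i * ξ j = ξ.ofLp ⬝ᵥ (A x).mulVec ξ.ofLp := by
    simp only [dotProduct, Matrix.mulVec, Finset.mul_sum]
    refine Finset.sum_congr rfl fun i _ => Finset.sum_congr rfl fun j _ => ?_
    ring
  rw [e1, e2]
  exact h ξ.ofLp

theorem convex_K (d : ℕ) (α β : ℝ) : Convex ℝ (K d α β) := by
  intro A hA B hB a b ha hb hab
  rw [mem_K_iff] at hA hB ⊢
  refine ⟨(hA.1.smul a).add (hB.1.smul b), fun ξ => ?_⟩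
  obtain ⟨h1, h2⟩ := hA.2 ξ
  obtain ⟨h3, h4⟩ := hB.2 ξ
  simp only [Matrix.add_mulVec, Matrix.smul_mulVec, dotProduct_add, dotProduct_smul, smul_eq_mul]
  have e : ∀ c : ℝ, c * (ξ ⬝ᵥ ξ) = a * (c * (ξ ⬝ᵥ ξ)) + b * (c * (ξ ⬝ᵥ ξ)) := by
    intro c
    rw [← add_mul, hab, one_mul]
  rw [e α, e β]
  exact ⟨by gcongr, by gcongr⟩

theorem Admissible.segment {d : ℕ} {Ω : Set (E d)} {α β : ℝ}
    {A B : E d → Matrix (Fin d) (Fin d) ℝ} (hA : A ∈ Admissible Ω α β)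
    (hB : B ∈ Admissible Ω α β) {t : ℝ} (h0 : 0 ≤ t) (h1 : t ≤ 1) :
    (fun x => A x + t • (B x - A x)) ∈ Admissible Ω α β := by
  refine admissible_of_ae_mem_K 
    ((Admissible.bddField hA).add (((Admissible.bddField hB).sub hA.1).smul t)) ?_
  filter_upwards [ae_mem_K_of_admissible hA, ae_mem_K_of_admissible hB] with x hx hx'
  exact (convex_K d α β).add_smul_sub_mem hx hx' ⟨h0, h1⟩

/-! ### Weak solutions -/

/-- Test functions approximating `z` vanish on the frontier, which an open set does not meet. Adding
them to the smooth approximants of `u` leaves the boundary values unchanged. -/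
theorem HasTrace.add_of_mem_H10 {d : ℕ} {Ω : Set (E d)} (hΩ : IsOpen Ω) {u z : H1 Ω}
    {g : Lp ℝ 2 (surface Ω)} (hu : HasTrace u g) (hz : z ∈ H10 Ω) : HasTrace (u + z) g := by
  obtain ⟨φ, v, hφ, hv, hvu, hφg⟩ := hu
  obtain ⟨y, hy, hyz⟩ := mem_closure_iff_seq_limit.mp hz
  choose χ hχ hyχ using hy
  refine ⟨fun n => φ n + χ n, fun n => v n + y n, fun n => (hφ n).add (hχ n).smooth, fun n => ?_,
    hvu.add hyz, ?_⟩
  · exact (Lp.coeFn_add (toL2 (v n)) (toL2 (y n))).trans ((hv n).add (hyχ n))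
  · refine hφg.congr fun n => eLpNorm_congr_ae ?_
    filter_upwards [ae_restrict_mem (isClosed_frontier (s := Ω)).measurableSet] with x hx
    have hxΩ : x ∉ Ω := fun h => hΩ.inter_frontier_eq.subset ⟨h, hx⟩
    have : χ n x = 0 := image_eq_zero_of_notMem_tsupport fun h => hxΩ ((hχ n).support_subset h)
    rw [Pi.add_apply, this, add_zero]

/-- The Lax–Milgram theorem for the form `(z, v) ↦ ⟪T (D z), D v⟫` on a complete subspace. -/
theorem exists_lax_milgram {H X : Type*} [NormedAddCommGroup H] [InnerProductSpace ℝ H]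
    [NormedAddCommGroup X] [InnerProductSpace ℝ X] (S : Submodule ℝ H) [CompleteSpace S]
    (D : H →L[ℝ] X) {C a : ℝ} (hC : 0 < C) (ha : 0 < a)
    (hP : ∀ w ∈ S, ‖w‖ ^ 2 ≤ C * ‖D w‖ ^ 2) {T : X →L[ℝ] X}
    (hT : ∀ G, a * ‖G‖ ^ 2 ≤ inner ℝ (T G) G) (F : StrongDual ℝ H) :
    ∃ z ∈ S, ∀ v ∈ S, inner ℝ (T (D z)) (D v) = F v := by
  let D' : S →L[ℝ] X := D.comp S.subtypeL
  let b : S →L[ℝ] S →L[ℝ] ℝ := (innerSL ℝ).bilinearComp (T.comp D') D'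
  have hb : ∀ z v : S, b z v = inner ℝ (T (D z)) (D v) := fun z v => rfl
  have hcoer : IsCoercive b := by
    -- `b z z ≥ a‖D z‖² ≥ (a / C)‖z‖²`, from the lower bound on `T` and the Poincaré-type bound
    -- `hP`.
    refine ⟨a / C, by positivity, fun z => ?_⟩
    rw [hb]
    have h1 := hP z z.2
    have h2 := hT (D z)
    rw [mul_assoc, ← sq, div_mul_eq_mul_div, div_le_iff₀ hC, Submodule.coe_norm]
    nlinarith
  let y : S := (InnerProductSpace.toDual ℝ S).symm (F.comp S.subtypeL)
  let z : S := hcoer.continuousLinearEquivOfBilin.symm y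
  refine ⟨z, z.2, fun v hv => ?_⟩
  have h1 := hcoer.continuousLinearEquivOfBilin_apply z ⟨v, hv⟩
  rw [ContinuousLinearEquiv.apply_symm_apply, InnerProductSpace.toDual_symm_apply, hb] at h1
  exact h1.symm

/-- Existence of weak solutions in `H¹₀(Ω)` for a coercive coefficient operator. -/
theorem exists_weak_solution {d : ℕ} {Ω : Set (E d)} {C a : ℝ} (hC : 0 < C) (ha : 0 < a)
    (hP : ∀ w ∈ H10 Ω, ‖w‖ ^ 2 ≤ C * ‖grad w‖ ^ 2) {T : L2Vec Ω →L[ℝ] L2Vec Ω}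
    (hT : ∀ G, a * ‖G‖ ^ 2 ≤ inner ℝ (T G) G) (F : StrongDual ℝ (H1 Ω)) :
    ∃ z ∈ H10 Ω, ∀ v ∈ H10 Ω, inner ℝ (T (grad z)) (grad v) = F v :=
  exists_lax_milgram (H10 Ω) (gradL Ω) hC ha hP hT F

/-- Testing with the difference makes its gradient vanish by coercivity, and Poincaré's inequality
then makes the difference itself vanish. -/
theorem eq_of_weak_solution {d : ℕ} {Ω : Set (E d)} {C a : ℝ} (ha : 0 < a)
    (hP : ∀ w ∈ H10 Ω, ‖w‖ ^ 2 ≤ C * ‖grad w‖ ^ 2) {T : L2Vec Ω →L[ℝ] L2Vec Ω}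
    (hT : ∀ G, a * ‖G‖ ^ 2 ≤ inner ℝ (T G) G) {y z : H1 Ω} (hy : y ∈ H10 Ω) (hz : z ∈ H10 Ω)
    (h : ∀ v ∈ H10 Ω, inner ℝ (T (grad y)) (grad v) = inner ℝ (T (grad z)) (grad v)) :
    y = z := by
  have hm := (H10 Ω).sub_mem hy hz
  have hsub : grad (y - z) = grad y - grad z := map_sub (gradL Ω) y z
  have h1 := hT (grad (y - z))
  have h2 : inner ℝ (T (grad (y - z))) (grad (y - z)) = 0 := by
    have := h _ hm
    conv_lhs => rw [hsub, map_sub, inner_sub_left, ← hsub, this, sub_self]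
  have h3 : ‖grad (y - z)‖ ^ 2 = 0 := by
    nlinarith [sq_nonneg ‖grad (y - z)‖]
  have h4 := hP _ hm
  rw [h3, mul_zero] at h4
  have h5 : ‖y - z‖ = 0 := by nlinarith [sq_nonneg ‖y - z‖]
  exact sub_eq_zero.mp (norm_eq_zero.mp h5)

theorem isState_iff {d : ℕ} {Ω : Set (E d)} {A : E d → Matrix (Fin d) (Fin d) ℝ}
    (hA : BddField Ω A) {f : StrongDual ℝ (H1 Ω)} {g : Lp ℝ 2 (surface Ω)} {u : H1 Ω} :
    IsState A f g u ↔ HasTrace u g ∧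
      ∀ v ∈ H10 Ω, inner ℝ (multiplier hA (grad u)) (grad v) = f v := by
  simp only [IsState, inner_multiplier]

theorem isAdjoint_iff {d : ℕ} {Ω : Set (E d)} {A : E d → Matrix (Fin d) (Fin d) ℝ}
    (hA : BddField Ω A) {h : L2Vec Ω} {u p : H1 Ω} :
    IsAdjoint A h u p ↔ p ∈ H10 Ω ∧
      ∀ v ∈ H10 Ω, inner ℝ (multiplier hA (grad p)) (grad v) =
        - inner ℝ (multiplier hA (multiplier hA (grad u) - h)) (grad v) := by
  unfold IsAdjoint
  refine and_congr_right fun _ => forall₂_congr fun v _ => ?_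
  rw [inner_multiplier, inner_multiplier]
  have : ∫ x in Ω, inner ℝ (act (A x) ((multiplier hA (grad u) - h) x)) (grad v x) =
      ∫ x in Ω, inner ℝ (act (A x) (act (A x) (grad u x) - h x)) (grad v x) := by
    refine integral_congr_ae ?_
    filter_upwards [coeFn_multiplier hA (grad u),
      Lp.coeFn_sub (multiplier hA (grad u)) h] with x h1 h2
    rw [h2, Pi.sub_apply, h1]
  rw [this]

/-- Take any extension `u₀` of the boundary datum and correct it by an element of `H¹₀` that solves
the problem with load `f` minus the contribution of `A∇u₀`. -/
theorem exists_isState {d : ℕ} {Ω : Set (E d)} (hΩ : IsOpen Ω) {α β C : ℝ} (hα : 0 < α)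
    (hC : 0 < C) (hP : ∀ w ∈ H10 Ω, ‖w‖ ^ 2 ≤ C * ‖grad w‖ ^ 2)
    {A : E d → Matrix (Fin d) (Fin d) ℝ} (hA : A ∈ Admissible Ω α β)
    (f : StrongDual ℝ (H1 Ω)) {g : Lp ℝ 2 (surface Ω)} (hg : g ∈ HHalf Ω) :
    ∃ u : H1 Ω, IsState A f g u := by
  obtain ⟨u₀, hu₀⟩ := hg
  obtain ⟨z, hz, hz'⟩ := exists_weak_solution hC hα hP (Admissible.le_inner_multiplier hA)
    (f - (innerSL ℝ (multiplier hA.1 (grad u₀))).comp (gradL Ω))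
  refine ⟨u₀ + z, (isState_iff hA.1).mpr ⟨hu₀.add_of_mem_H10 hΩ hz, fun v hv => ?_⟩⟩
  have h1 := hz' v hv
  rw [show grad (u₀ + z) = grad u₀ + grad z from rfl, map_add, inner_add_left, h1]
  simp

theorem existsUnique_isAdjoint {d : ℕ} {Ω : Set (E d)} {α β C : ℝ} (hα : 0 < α)
    (hC : 0 < C) (hP : ∀ w ∈ H10 Ω, ‖w‖ ^ 2 ≤ C * ‖grad w‖ ^ 2)
    {A : E d → Matrix (Fin d) (Fin d) ℝ} (hA : A ∈ Admissible Ω α β) (h : L2Vec Ω) (u : H1 Ω) :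
    ∃! p : H1 Ω, IsAdjoint A h u p := by
  obtain ⟨p, hp, hp'⟩ := exists_weak_solution hC hα hP (Admissible.le_inner_multiplier hA)
    (-(innerSL ℝ (multiplier hA.1 (multiplier hA.1 (grad u) - h))).comp (gradL Ω))
  have hadj : IsAdjoint A h u p := (isAdjoint_iff hA.1).mpr ⟨hp, hp'⟩
  refine ⟨p, hadj, fun q hq => ?_⟩
  replace hq := (isAdjoint_iff hA.1).mp hq
  replace hadj := (isAdjoint_iff hA.1).mp hadj
  exact eq_of_weak_solution hα hP (Admissible.le_inner_multiplier hA) hq.1 hp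
    fun v hv => (hq.2 v hv).trans (hadj.2 v hv).symm

/-! ### First variation of the functional -/

/-- Second-order expansion of the misfit along a perturbation `S + t R` of the operator `S`, in
terms of the adjoint variable `y`. -/
theorem misfit_expansion {X : Type*} [NormedAddCommGroup X] [InnerProductSpace ℝ X]
    (S R : X →L[ℝ] X) (hS : ∀ a b, inner ℝ (S a) b = inner ℝ a (S b)) (x y z h : X) {t C : ℝ}
    (ht : 0 < t) (ht1 : t ≤ 1) (hz : ‖z‖ ≤ t * C)
    (hadj : inner ℝ (S y) z = - inner ℝ (S (S x - h)) z)
    (hvar : inner ℝ (S z + t • R z) y = - (t * inner ℝ (R x) y)) :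
    1 / 2 * ‖S (x + z) + t • R (x + z) - h‖ ^ 2 ≤ 1 / 2 * ‖S x - h‖ ^ 2 +
      t * (inner ℝ (R x) (S x - h) + inner ℝ (R x) y) +
      t ^ 2 * (1 / 2 * (‖R x‖ + ‖S‖ * C + ‖R‖ * C) ^ 2 +
        (‖S x - h‖ + ‖y‖) * (‖R‖ * C)) := by
  -- In the application `S` and `R` multiply by `A` and `B - A`, and `x`, `y`, `z` are `∇u`, `∇p`
  -- and the change of `∇u`. Here `r` is the residual and `e` its increment.
  set r := S x - h with hr
  set e := t • R x + S z + t • R z with he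
  have h0 : S (x + z) + t • R (x + z) - h = r + e := by
    rw [hr, he, map_add, map_add, smul_add]
    abel
  have hC : 0 ≤ C := by
    have := (norm_nonneg z).trans hz
    exact nonneg_of_mul_nonneg_right this ht
  have hRz : ‖R z‖ ≤ t * (‖R‖ * C) := by
    calc ‖R z‖ ≤ ‖R‖ * ‖z‖ := R.le_opNorm z
      _ ≤ ‖R‖ * (t * C) := by gcongr
      _ = t * (‖R‖ * C) := by ring
  have hSz : ‖S z‖ ≤ t * (‖S‖ * C) := by
    calc ‖S z‖ ≤ ‖S‖ * ‖z‖ := S.le_opNorm z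
      _ ≤ ‖S‖ * (t * C) := by gcongr
      _ = t * (‖S‖ * C) := by ring
  have hRC : 0 ≤ ‖R‖ * C := by positivity
  have hen : ‖e‖ ≤ t * (‖R x‖ + ‖S‖ * C + ‖R‖ * C) := by
    have h1 : ‖e‖ ≤ ‖t • R x‖ + ‖S z‖ + ‖t • R z‖ := norm_add₃_le
    rw [norm_smul, norm_smul, Real.norm_of_nonneg ht.le] at h1
    have h2 : t * ‖R z‖ ≤ 1 * ‖R z‖ := by gcongr
    linarith
  have hesq : ‖e‖ ^ 2 ≤ t ^ 2 * (‖R x‖ + ‖S‖ * C + ‖R‖ * C) ^ 2 := by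
    rw [← mul_pow]
    exact pow_le_pow_left₀ (norm_nonneg _) hen 2
  -- The adjoint trick: symmetry of `S` and `hadj` give `⟨r, S z⟩ = -⟨S z, y⟩`, and `hvar` expresses
  -- the latter through `R`, leaving `z` only in a term of order `t²`.
  have hrS : inner ℝ r (S z) = t * inner ℝ (R x) y + t * inner ℝ (R z) y := by
    rw [inner_add_left, real_inner_smul_left] at hvar
    rw [hS, hS r] at hadj
    rw [real_inner_comm] at hadj
    linarith
  have hre : inner ℝ r e = t * (inner ℝ (R x) r + inner ℝ (R x) y) +
      t * (inner ℝ (R z) y + inner ℝ (R z) r) := by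
    rw [he, inner_add_right, inner_add_right, hrS, real_inner_smul_right, real_inner_smul_right,
      real_inner_comm (R x) r, real_inner_comm (R z) r]
    ring
  have h3 : inner ℝ (R z) y ≤ t * (‖R‖ * C) * ‖y‖ :=
    (real_inner_le_norm _ _).trans (by gcongr)
  have h4 : inner ℝ (R z) r ≤ t * (‖R‖ * C) * ‖r‖ :=
    (real_inner_le_norm _ _).trans (by gcongr)
  have h5 : t * (inner ℝ (R z) y + inner ℝ (R z) r) ≤
      t * (t * (‖R‖ * C) * ‖y‖ + t * (‖R‖ * C) * ‖r‖) := by gcongr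
  rw [h0, norm_add_sq_real, hre]
  nlinarith

theorem setIntegral_misfit {d : ℕ} {Ω : Set (E d)} {A : E d → Matrix (Fin d) (Fin d) ℝ}
    (hA : BddField Ω A) (G h : L2Vec Ω) :
    ∫ x in Ω, ‖act (A x) (G x) - h x‖ ^ 2 = ‖multiplier hA G - h‖ ^ 2 := by
  rw [← real_inner_self_eq_norm_sq, L2.inner_def]
  refine integral_congr_ae ?_
  filter_upwards [coeFn_multiplier hA G, Lp.coeFn_sub (multiplier hA G) h] with x h1 h2
  rw [h2, Pi.sub_apply, h1, real_inner_self_eq_norm_sq]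

theorem frob_add_left {d : ℕ} (A B M : Matrix (Fin d) (Fin d) ℝ) :
    frob (A + B) M = frob A M + frob B M := by
  simp only [frob, Matrix.add_apply, add_mul, Finset.sum_add_distrib]

theorem frob_smul_left {d : ℕ} (c : ℝ) (A M : Matrix (Fin d) (Fin d) ℝ) :
    frob (c • A) M = c * frob A M := by
  simp only [frob, Matrix.smul_apply, smul_eq_mul, mul_assoc, Finset.mul_sum]

theorem frob_comm {d : ℕ} (A B : Matrix (Fin d) (Fin d) ℝ) : frob A B = frob B A :=
  Finset.sum_congr rfl fun _ _ => Finset.sum_congr rfl fun _ _ => mul_comm _ _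

theorem frob_add_right {d : ℕ} (A B M : Matrix (Fin d) (Fin d) ℝ) :
    frob M (A + B) = frob M A + frob M B := by
  rw [frob_comm, frob_add_left, frob_comm A, frob_comm B]

theorem frob_smul_right {d : ℕ} (c : ℝ) (A M : Matrix (Fin d) (Fin d) ℝ) :
    frob M (c • A) = c * frob M A := by
  rw [frob_comm, frob_smul_left, frob_comm A]

theorem frob_sum_left {d : ℕ} {ι : Type*} (s : Finset ι) (A : ι → Matrix (Fin d) (Fin d) ℝ)
    (M : Matrix (Fin d) (Fin d) ℝ) : frob (∑ i ∈ s, A i) M = ∑ i ∈ s, frob (A i) M := by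
  let F : Matrix (Fin d) (Fin d) ℝ →+ ℝ :=
    ⟨⟨fun N => frob N M, by simp [frob]⟩, fun N N' => frob_add_left N N' M⟩
  exact map_sum F A s

theorem continuous_frob {d : ℕ} (A : Matrix (Fin d) (Fin d) ℝ) : Continuous (frob A) :=
  continuous_finsetSum _ fun i _ => continuous_finsetSum _ fun j _ =>
    continuous_const.mul (continuous_id.matrix_elem i j)

/-- On a finite measure space bounded entries are square integrable, so the products are integrable.
-/
theorem integrable_frob {d : ℕ} {Ω : Set (E d)} [IsFiniteMeasure (volume.restrict Ω)]
    {A B : E d → Matrix (Fin d) (Fin d) ℝ} (hA : BddField Ω A) (hB : BddField Ω B) :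
    Integrable (fun x => frob (A x) (B x)) (volume.restrict Ω) :=
  integrable_finsetSum _ fun i _ => integrable_finsetSum _ fun j _ =>
    ((hA i j).mono_exponent le_top).integrable_mul (p := 2) (q := 2)
      ((hB i j).mono_exponent le_top)

/-- The derivative of a single misfit term, paired with a symmetric matrix field. -/
theorem frob_misfit_gradient_ae {d : ℕ} {Ω : Set (E d)} {A H : E d → Matrix (Fin d) (Fin d) ℝ}
    (hA : BddField Ω A) (hH : BddField Ω H) (hs : ∀ᵐ x ∂volume.restrict Ω, (H x).IsSymm)
    (G P h : L2Vec Ω) :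
    (fun x => inner ℝ (multiplier hH G x) ((multiplier hA G - h) x) +
      inner ℝ (multiplier hH G x) (P x)) =ᵐ[volume.restrict Ω]
    fun x => frob (symTensor (G x) (act (A x) (G x) - h x) + symTensor (G x) (P x)) (H x) := by
  filter_upwards [hs, coeFn_multiplier hH G, coeFn_multiplier hA G,
    Lp.coeFn_sub (multiplier hA G) h] with x h1 h2 h3 h4
  rw [frob_add_left, frob_symTensor _ _ h1, frob_symTensor _ _ h1, h2, h4, Pi.sub_apply, h3]

theorem integrable_frob_misfit_gradient {d : ℕ} {Ω : Set (E d)}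
    {A H : E d → Matrix (Fin d) (Fin d) ℝ}
    (hA : BddField Ω A) (hH : BddField Ω H) (hs : ∀ᵐ x ∂volume.restrict Ω, (H x).IsSymm)
    (G P h : L2Vec Ω) :
    Integrable (fun x => frob (symTensor (G x) (act (A x) (G x) - h x) + symTensor (G x) (P x))
      (H x)) (volume.restrict Ω) :=
  ((L2.integrable_inner (𝕜 := ℝ) _ _).add (L2.integrable_inner (𝕜 := ℝ) _ _)).congr
    (frob_misfit_gradient_ae hA hH hs G P h)

theorem integral_frob_misfit_gradient {d : ℕ} {Ω : Set (E d)}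
    {A H : E d → Matrix (Fin d) (Fin d) ℝ}
    (hA : BddField Ω A) (hH : BddField Ω H) (hs : ∀ᵐ x ∂volume.restrict Ω, (H x).IsSymm)
    (G P h : L2Vec Ω) :
    ∫ x in Ω, frob (symTensor (G x) (act (A x) (G x) - h x) + symTensor (G x) (P x)) (H x) =
      inner ℝ (multiplier hH G) (multiplier hA G - h) + inner ℝ (multiplier hH G) P := by
  rw [← integral_congr_ae (frob_misfit_gradient_ae hA hH hs G P h),
    integral_add (L2.integrable_inner (𝕜 := ℝ) _ _) (L2.integrable_inner (𝕜 := ℝ) _ _),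
    ← L2.inner_def, ← L2.inner_def]

theorem Admissible.ae_isSymm_sub {d : ℕ} {Ω : Set (E d)} {α β : ℝ}
    {A B : E d → Matrix (Fin d) (Fin d) ℝ} (hA : A ∈ Admissible Ω α β)
    (hB : B ∈ Admissible Ω α β) : ∀ᵐ x ∂volume.restrict Ω, (B x - A x).IsSymm := by
  filter_upwards [Admissible.ae_isSymm hA, Admissible.ae_isSymm hB] with x h1 h2
  exact h2.sub h1

/-- The states of the perturbed coefficients `A + t (B - A)` and the second-order expansion of
their misfit. -/
theorem exists_isState_segment {d : ℕ} {Ω : Set (E d)} (hΩ : IsOpen Ω) {α β C : ℝ} (hα : 0 < α)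
    (hC : 0 < C) (hP : ∀ w ∈ H10 Ω, ‖w‖ ^ 2 ≤ C * ‖grad w‖ ^ 2)
    {A B : E d → Matrix (Fin d) (Fin d) ℝ} (hA : A ∈ Admissible Ω α β)
    (hB : B ∈ Admissible Ω α β) {f : StrongDual ℝ (H1 Ω)} {g : Lp ℝ 2 (surface Ω)}
    {h : L2Vec Ω} {u p : H1 Ω} (hu : IsState A f g u) (hp : IsAdjoint A h u p) :
    ∃ D : ℝ, ∀ t : ℝ, 0 < t → t ≤ 1 → ∃ w : H1 Ω,
      IsState (fun x => A x + t • (B x - A x)) f g w ∧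
      1 / 2 * (∫ x in Ω, ‖act (A x + t • (B x - A x)) (grad w x) - h x‖ ^ 2) ≤
        1 / 2 * (∫ x in Ω, ‖act (A x) (grad u x) - h x‖ ^ 2) +
        t * (∫ x in Ω, frob (symTensor (grad u x) (act (A x) (grad u x) - h x) +
          symTensor (grad u x) (grad p x)) (B x - A x)) + t ^ 2 * D := by
  have hH : BddField Ω (fun x => B x - A x) := (Admissible.bddField hB).sub hA.1
  rw [isState_iff hA.1] at hu
  rw [isAdjoint_iff hA.1] at hp
  have hsymm := inner_multiplier_comm hA.1 (Admissible.ae_isSymm hA)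
  rw [integral_frob_misfit_gradient hA.1 hH (Admissible.ae_isSymm_sub hA hB),
    setIntegral_misfit hA.1]
  -- The remainder constant of `misfit_expansion` with `C = ‖H∇u‖ / α`, where `H = B - A`; it does
  -- not depend on `t`.
  refine ⟨1 / 2 * (‖multiplier hH (grad u)‖ +
    ‖multiplier hA.1‖ * (‖multiplier hH (grad u)‖ / α) +
    ‖multiplier hH‖ * (‖multiplier hH (grad u)‖ / α)) ^ 2 +
    (‖multiplier hA.1 (grad u) - h‖ + ‖grad p‖) *
      (‖multiplier hH‖ * (‖multiplier hH (grad u)‖ / α)), fun t ht ht1 => ?_⟩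
  have hAt := Admissible.segment hA hB ht.le ht1
  have hcoer := Admissible.le_inner_multiplier hAt
  have hsplit := multiplier_add_smul hA.1 hH t
  -- The right-hand side is what remains after subtracting the equation of `u` from that of the
  -- perturbed state.
  obtain ⟨z, hz, hz'⟩ := exists_weak_solution hC hα hP hcoer
    (-(t • (innerSL ℝ (multiplier hH (grad u))).comp (gradL Ω)))
  replace hz' : ∀ v ∈ H10 Ω, inner ℝ (multiplier hAt.1 (grad z)) (grad v) =
    - (t * inner ℝ (multiplier hH (grad u)) (grad v)) := hz'
  have hgrad : grad (u + z) = grad u + grad z := rfl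
  refine ⟨u + z, (isState_iff hAt.1).mpr ⟨hu.1.add_of_mem_H10 hΩ hz, fun v hv => ?_⟩, ?_⟩
  · rw [hgrad, map_add, inner_add_left, hz' v hv, hsplit, inner_add_left, hu.2 v hv,
      real_inner_smul_left]
    ring
  · rw [setIntegral_misfit hAt.1, hsplit, hgrad]
    refine misfit_expansion _ _ hsymm _ _ _ _ ht ht1 ?_ (hp.2 z hz) ?_
    · have h1 := (hcoer (grad z)).trans_eq (hz' z hz)
      have h2 := neg_le_of_abs_le (abs_real_inner_le_norm (multiplier hH (grad u)) (grad z))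
      rw [← mul_div_assoc, le_div_iff₀ hα]
      rcases (norm_nonneg (grad z)).eq_or_lt with h0 | h0
      · rw [← h0, zero_mul]
        positivity
      · nlinarith
    · rw [← hsplit]
      exact hz' p hp.1

/-- Divide by `t` and let `t` decrease to `0`. -/
theorem nonneg_of_forall_add_sq_mul {a b : ℝ}
    (h : ∀ t : ℝ, 0 < t → t ≤ 1 → 0 ≤ t * a + t ^ 2 * b) : 0 ≤ a := by
  have hlim : Tendsto (fun t : ℝ => a + t * b) (𝓝[>] 0) (𝓝 a) := by
    have : Tendsto (fun t : ℝ => a + t * b) (𝓝 0) (𝓝 (a + 0 * b)) :=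
      (continuous_const.add (continuous_id.mul continuous_const)).tendsto 0
    rw [zero_mul, add_zero] at this
    exact this.mono_left nhdsWithin_le_nhds
  refine ge_of_tendsto hlim ?_
  filter_upwards [Ioc_mem_nhdsGT (zero_lt_one' ℝ)] with t ht
  have h1 := h t ht.1 ht.2
  rw [show t * a + t ^ 2 * b = t * (a + t * b) by ring] at h1
  exact nonneg_of_mul_nonneg_right h1 ht.1

/-- The `L²` gradient of the Tikhonov functional at `A`, with states `u` and adjoints `p`. -/
def tikhonovGradient {d L : ℕ} {Ω : Set (E d)} (γ : ℝ) (h : Fin L → L2Vec Ω)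
    (A : E d → Matrix (Fin d) (Fin d) ℝ) (u p : Fin L → H1 Ω) (x : E d) :
    Matrix (Fin d) (Fin d) ℝ :=
  ∑ ℓ, (symTensor (grad (u ℓ) x) (act (A x) (grad (u ℓ) x) - h ℓ x) +
    symTensor (grad (u ℓ) x) (grad (p ℓ) x)) + γ • A x

theorem frob_tikhonovGradient {d L : ℕ} {Ω : Set (E d)} (γ : ℝ) (h : Fin L → L2Vec Ω)
    (A : E d → Matrix (Fin d) (Fin d) ℝ) (u p : Fin L → H1 Ω) (x : E d)
    (M : Matrix (Fin d) (Fin d) ℝ) :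
    frob (tikhonovGradient γ h A u p x) M =
      ∑ ℓ, frob (symTensor (grad (u ℓ) x) (act (A x) (grad (u ℓ) x) - h ℓ x) +
        symTensor (grad (u ℓ) x) (grad (p ℓ) x)) M + γ * frob (A x) M := by
  rw [tikhonovGradient, frob_add_left, frob_sum_left, frob_smul_left]

theorem integrable_frob_tikhonovGradient {d L : ℕ} {Ω : Set (E d)}
    [IsFiniteMeasure (volume.restrict Ω)] (γ : ℝ) (h : Fin L → L2Vec Ω)
    {A H : E d → Matrix (Fin d) (Fin d) ℝ} (u p : Fin L → H1 Ω)
    (hA : BddField Ω A) (hH : BddField Ω H) (hs : ∀ᵐ x ∂volume.restrict Ω, (H x).IsSymm) :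
    Integrable (fun x => frob (tikhonovGradient γ h A u p x) (H x)) (volume.restrict Ω) := by
  simp only [frob_tikhonovGradient]
  exact (integrable_finsetSum _ fun ℓ _ =>
    integrable_frob_misfit_gradient hA hH hs _ _ _).add ((integrable_frob hA hH).const_mul γ)

/-- The first-order necessary condition for a minimizer, in variational form. -/
theorem IsMinimizer.integral_frob_nonneg {d L : ℕ} {Ω : Set (E d)} (hΩ : IsOpen Ω)
    [IsFiniteMeasure (volume.restrict Ω)] {α β γ C : ℝ} (hα : 0 < α)
    (hC : 0 < C) (hP : ∀ w ∈ H10 Ω, ‖w‖ ^ 2 ≤ C * ‖grad w‖ ^ 2)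
    {f : Fin L → StrongDual ℝ (H1 Ω)} {g : Fin L → Lp ℝ 2 (surface Ω)} {h : Fin L → L2Vec Ω}
    {A B : E d → Matrix (Fin d) (Fin d) ℝ} (hA : IsMinimizer α β γ f g h A)
    (hB : B ∈ Admissible Ω α β) {u p : Fin L → H1 Ω} (hu : ∀ ℓ, IsState A (f ℓ) (g ℓ) (u ℓ))
    (hp : ∀ ℓ, IsAdjoint A (h ℓ) (u ℓ) (p ℓ)) :
    0 ≤ ∫ x in Ω, frob (tikhonovGradient γ h A u p x) (B x - A x) := by
  obtain ⟨hadm, hmin⟩ := hA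
  have hH : BddField Ω (fun x => B x - A x) := (Admissible.bddField hB).sub hadm.1
  have hs := Admissible.ae_isSymm_sub hadm hB
  choose D hD using fun ℓ => exists_isState_segment hΩ hα hC hP hadm hB (hu ℓ) (hp ℓ)
  refine nonneg_of_forall_add_sq_mul
    -- The misfit remainders together with the quadratic term of the regularization, whose expansion
    -- in `t` is exact.
    (b := ∑ ℓ, D ℓ + γ / 2 * ∫ x in Ω, frob (B x - A x) (B x - A x)) fun t ht ht1 => ?_
  choose w hw hwle using fun ℓ => hD ℓ t ht ht1
  have h1 := hmin _ (Admissible.segment hadm hB ht.le ht1) u w hu hw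
  have h2 := Finset.sum_le_sum fun ℓ (_ : ℓ ∈ Finset.univ) => hwle ℓ
  have h3 : ∫ x in Ω, frob (A x + t • (B x - A x)) (A x + t • (B x - A x)) =
      (∫ x in Ω, frob (A x) (A x)) + 2 * t * (∫ x in Ω, frob (A x) (B x - A x)) +
        t ^ 2 * ∫ x in Ω, frob (B x - A x) (B x - A x) := by
    have i1 := integrable_frob hadm.1 hadm.1
    have i2 := (integrable_frob hadm.1 hH).const_mul (2 * t)
    have i3 := (integrable_frob hH hH).const_mul (t ^ 2)
    rw [← integral_const_mul, ← integral_const_mul, ← integral_add i1 i2,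
      ← integral_add (i1.add i2 : Integrable (fun x => _ + _) _) i3]
    refine integral_congr_ae (.of_forall fun x => ?_)
    simp only [frob_add_left, frob_add_right, frob_smul_left, frob_smul_right,
      frob_comm (B x - A x) (A x)]
    ring
  simp only [frob_tikhonovGradient]
  rw [integral_add (integrable_finsetSum _ fun ℓ _ =>
      integrable_frob_misfit_gradient hadm.1 hH hs _ _ _) ((integrable_frob hadm.1 hH).const_mul γ),
    integral_finsetSum _ fun ℓ _ => integrable_frob_misfit_gradient hadm.1 hH hs _ _ _,
    integral_const_mul]
  unfold tikhonov at h1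
  rw [h3] at h1
  simp only [Finset.sum_add_distrib, ← Finset.mul_sum] at h2
  linarith

/-! ### Localization and the projection formula -/

/-- Adding the variational inequality of each projection tested with the other gives `‖P - Q‖² ≤ 0`
in the Frobenius norm. -/
theorem IsProjK.unique {d : ℕ} {α β : ℝ} {M P Q : Matrix (Fin d) (Fin d) ℝ}
    (hP : IsProjK α β M P) (hQ : IsProjK α β M Q) : P = Q := by
  have h1 := hP.2 Q hQ.1
  have h2 := hQ.2 P hP.1
  have h3 : frob (P - Q) (P - Q) = frob (M - P) (Q - P) + frob (M - Q) (P - Q) := by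
    simp only [frob, Matrix.sub_apply, ← Finset.sum_add_distrib]
    refine Finset.sum_congr rfl fun i _ => Finset.sum_congr rfl fun j _ => ?_
    ring
  have h4 : frob (P - Q) (P - Q) = 0 :=
    le_antisymm (by linarith) (Finset.sum_nonneg fun i _ => Finset.sum_nonneg fun j _ =>
      mul_self_nonneg _)
  ext i j
  have h5 := (Finset.sum_eq_zero_iff_of_nonneg fun i _ => Finset.sum_nonneg fun j _ =>
    mul_self_nonneg ((P - Q) i j)).mp h4 i (Finset.mem_univ i)
  have h6 := (Finset.sum_eq_zero_iff_of_nonneg fun j _ =>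
    mul_self_nonneg ((P - Q) i j)).mp h5 j (Finset.mem_univ j)
  exact sub_eq_zero.mp (mul_self_eq_zero.mp h6)

theorem piecewise_mem_admissible {d : ℕ} {Ω S : Set (E d)} [DecidablePred (· ∈ S)]
    (hS : MeasurableSet S) [IsFiniteMeasure (volume.restrict Ω)] {α β : ℝ}
    {A : E d → Matrix (Fin d) (Fin d) ℝ} (hA : A ∈ Admissible Ω α β)
    {M : Matrix (Fin d) (Fin d) ℝ} (hM : M ∈ K d α β) :
    S.piecewise (fun _ => M) A ∈ Admissible Ω α β := by
  refine admissible_of_ae_mem_K (fun i j => ?_) ?_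
  · have h1 : MemLp (S.piecewise (fun _ => M i j) fun x => A x i j) ∞ (volume.restrict Ω) :=
      MemLp.piecewise hS (memLp_const _) ((hA.1 i j).restrict _)
    convert h1 using 2 with x
    by_cases hx : x ∈ S <;> simp [hx]
  · filter_upwards [ae_mem_K_of_admissible hA] with x hx
    by_cases hxS : x ∈ S <;> simp [hxS, hx, hM]

/-- A variational inequality over the admissible set holds pointwise almost everywhere. -/
theorem ae_forall_frob_nonneg {d : ℕ} {Ω : Set (E d)} [IsFiniteMeasure (volume.restrict Ω)]
    {α β : ℝ} {A G : E d → Matrix (Fin d) (Fin d) ℝ} (hA : A ∈ Admissible Ω α β)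
    (hint : ∀ B ∈ Admissible Ω α β,
      Integrable (fun x => frob (G x) (B x - A x)) (volume.restrict Ω))
    (hG : ∀ B ∈ Admissible Ω α β, 0 ≤ ∫ x in Ω, frob (G x) (B x - A x)) :
    ∀ᵐ x ∂volume.restrict Ω, ∀ M ∈ K d α β, 0 ≤ frob (G x) (M - A x) := by
  classical
  have : SecondCountableTopology (Matrix (Fin d) (Fin d) ℝ) :=
    inferInstanceAs (SecondCountableTopology (Fin d → Fin d → ℝ))
  have : TopologicalSpace.PseudoMetrizableSpace (Matrix (Fin d) (Fin d) ℝ) :=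
    inferInstanceAs (TopologicalSpace.PseudoMetrizableSpace (Fin d → Fin d → ℝ))
  -- For a fixed `M` the exceptional null set depends on `M`. A countable dense subset of `K` gives
  -- a single null set, and continuity of the pairing extends the inequality to all of `K`.
  obtain ⟨c, hcK, hcc, hdense⟩ :=
    (TopologicalSpace.IsSeparable.of_separableSpace (K d α β)).exists_countable_dense_subset
  have hpt : ∀ M ∈ c, ∀ᵐ x ∂volume.restrict Ω, 0 ≤ frob (G x) (M - A x) := by
    intro M hM
    have hcst : (fun _ => M) ∈ Admissible Ω α β :=
      admissible_of_ae_mem_K (fun i j => memLp_const _) (.of_forall fun _ => hcK hM)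
    refine ae_nonneg_of_forall_setIntegral_nonneg (hint _ hcst) fun S hS _ => ?_
    -- This competitor differs from `A` only on `S`, so the global inequality becomes one for the
    -- integral over `S`, and `S` is arbitrary.
    have h1 := hG _ (piecewise_mem_admissible hS hA (hcK hM))
    rw [← integral_indicator hS]
    refine h1.trans_eq (integral_congr_ae (.of_forall fun x => ?_))
    by_cases hx : x ∈ S <;> simp [hx, frob]
  filter_upwards [(ae_ball_iff hcc).mpr hpt] with x hx M hM
  have hcl : IsClosed {N | 0 ≤ frob (G x) (N - A x)} :=
    isClosed_le continuous_const ((continuous_frob (G x)).comp (continuous_id.sub continuous_const))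
  exact closure_minimal (fun N hN => hx N hN) hcl (hdense hM)

/-- The vector from `P` to `P - lam • G` is `-lam • G`, so the inequality defining the projection is
the hypothesis multiplied by `-lam`. Uniqueness of the projection concludes. -/
theorem eq_projK_of_frob_nonneg {d : ℕ} {α β lam : ℝ} (hαβ : α ≤ β) (hlam : 0 ≤ lam)
    {P G : Matrix (Fin d) (Fin d) ℝ} (hP : P ∈ K d α β)
    (h : ∀ M ∈ K d α β, 0 ≤ frob G (M - P)) : P = projK α β (P - lam • G) := by
  refine IsProjK.unique ⟨hP, fun M hM => ?_⟩ (isProjK_projK hαβ _)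
  rw [show P - lam • G - P = (-lam) • G by rw [neg_smul]; abel, frob_smul_left]
  have := mul_nonneg hlam (h M hM)
  linarith

end

end AnisotropicConductivity

theorem theorem2p6 {d : ℕ} (hd : d = 2 ∨ d = 3) (Ω : Set (E d))
    (hΩ : IsBoundedLipschitzDomain Ω) (α β γ : ℝ) (hα : 0 < α) (hαβ : α < β) (hγ : 0 < γ)
    (L : ℕ) (f : Fin L → StrongDual ℝ (H1 Ω)) (g : Fin L → Lp ℝ 2 (surface Ω))
    (hg : ∀ ℓ, g ℓ ∈ HHalf Ω) (h : Fin L → L2Vec Ω)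
    (A : E d → Matrix (Fin d) (Fin d) ℝ) (hA : IsMinimizer α β γ f g h A) :
    (∀ ℓ, ∃ u : H1 Ω, IsState A (f ℓ) (g ℓ) u) ∧
    (∀ ℓ, ∀ u : H1 Ω, IsState A (f ℓ) (g ℓ) u → ∃! p : H1 Ω, IsAdjoint A (h ℓ) u p) ∧
    ∀ u p : Fin L → H1 Ω, (∀ ℓ, IsState A (f ℓ) (g ℓ) (u ℓ)) →
      (∀ ℓ, IsAdjoint A (h ℓ) (u ℓ) (p ℓ)) →
      ∀ lam : ℝ, 0 < lam → ∀ᵐ x ∂volume.restrict Ω,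
        A x = projK α β (A x - lam •
          (∑ ℓ, (symTensor (grad (u ℓ) x) (act (A x) (grad (u ℓ) x) - h ℓ x) +
            symTensor (grad (u ℓ) x) (grad (p ℓ) x)) + γ • A x)) := by
  have : IsFiniteMeasure (volume.restrict Ω) :=
    isFiniteMeasure_restrict.mpr hΩ.isBounded.measure_lt_top.ne
  obtain ⟨C, hC, hP⟩ := exists_norm_sq_le_grad (by omega) hΩ.isOpen.measurableSet hΩ.isBounded
  refine ⟨fun ℓ => exists_isState hΩ.isOpen hα hC hP hA.1 (f ℓ) (hg ℓ),
    fun ℓ u _ => existsUnique_isAdjoint hα hC hP hA.1 (h ℓ) u, fun u p hu hp lam hlam => ?_⟩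
  have hae := ae_forall_frob_nonneg (G := tikhonovGradient γ h A u p) hA.1
    (fun B hB => integrable_frob_tikhonovGradient γ h u p hA.1.1
      ((Admissible.bddField hB).sub hA.1.1) (Admissible.ae_isSymm_sub hA.1 hB))
    (fun B hB => hA.integral_frob_nonneg hΩ.isOpen hα hC hP hB hu hp)
  filter_upwards [hae, ae_mem_K_of_admissible hA.1] with x hx hxK
  exact eq_projK_of_frob_nonneg hαβ.le hlam.le hxK hx
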